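/- **The game.** A monopolist (the duropolist) sells a good at zero cost to $N$ consumers over $T\ge 1$ periods. The consumers' values, in decreasing order, are $v_1\ge v_2\ge\dots\ge v_N\ge 0$. In each period $t$ she announces a price $\mu_t$, and then the consumers who have not bought yet decide simultaneously whether to buy one unit. Her payoff is $\sum_t x_t\mu_t$, where $x_t$ is the number of buyers in period $t$; a consumer with value $v_i$ who buys in period $t$ gets $v_i-\mu_t$, and one who never buys gets $0$. Strategies are pure, prices and sets of buyers are publicly observed, and deviations may depend on the whole history. **Recursion.** Put $p(i,T+1)=v_i$ and $\Pi(i,T+1)=0$, and for $t\le T$ let $$j^*(i,t)\in\arg\max_{j\ge i}\big((j-i+1)\,p(j,t+1)+\Pi(j+1,t+1)\big),\qquad p(i,t)=p(j^*(i,t),t+1),$$ $$\Pi(i,t)=(j^*(i,t)-i+1)\,p(j^*(i,t),t+1)+\Pi(j^*(i,t)+1,t+1),$$ ties being broken by an arbitrary rule that depends only on the list of values concerned and on the number of periods left. The threat price of $i$ in period $t<T$ is $\tau(i,t)=p(i,t+1)$. Let $\Pi^D=\Pi(1,1)$, $\Pi^M=\max_j j\,v_j$ (which is $0$ if $N=0$),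 and let $p_1=p(1,T)$ be the static monopoly price. In the *complete information* setting the strategies are: when the set $S$ of consumers remains in period $t$, the duropolist charges the first price of this recursion for the game $\mathcal G$ with the $T-t+1$ remaining periods and the consumers $S$, and a remaining consumer buys iff the price is at most her threat price in $\mathcal G$ (in period $T$: at most her value). **Incomplete information.** The list $v_1,\dots,v_N$ is commonly known; each consumer knows which position in the list is her own, and nobody knows anything else about who has which value. The duropolist believes after every history, on or off the path, that the buyers of each past period were the highest-valued consumers then remaining (equal values being ordered by position); a consumer believes this of the others and knows her own value. If $m$ consumers remain in period $t$, let $\mathcal G'$ be the game with $T-t+1$ periods and the $m$ lowest values $v_{N-m+1},\dots,v_N$. The duropolist charges the first price of the recursion for $\mathcal G'$, that is, $p(N-m+1,t)$. A remaining consumer buys iff the price is at most her threat price as calculated for $\mathcal G'$ at her rank among the remaining consumers (in period $T$: at most her own value). A consumer cannot observe this rank, so it is the rank according to her belief: with value $v_k$ she uses $\tau(\max(k,N-m+1),t)$. **Theorem.** 1. These strategies, with these beliefs, constitute a subgame perfect equilibrium of the incomplete information game. That is: strategies and beliefs depend only on what the player knows; the beliefs allow at least one assignment of the values to the consumers after every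 history, and on the path of play they allow exactly those assignments that agree with the player's own information and lead to the observed history; after every history and (for consumers) every announced price, no player can gain by any deviation from her continuation strategy, in any assignment that she considers possible. 2. The same holds when the duropolist has the information and beliefs above, while the consumers know who has which value and each remaining consumer uses the threat price calculated for $\mathcal G'$ at her actual rank: in every subgame with any set $S$ of remaining consumers, no consumer can gain by any deviation given the actual values in $S$, and the duropolist cannot gain given her belief. 3. For every assignment of the values to the consumers, the path of play (the prices and the sets of buyers of all periods) of both profiles is that of the complete information strategies. The duropolist's profit on it is $\Pi^D$, and $$\Pi^M\le\Pi^D\le\Pi^M+p_1\le 2\,\Pi^M .$$ -/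

import Mathlib

/-!
The finite-horizon durable-good monopoly ("duropoly") game with `N` consumers and `T` periods.
Positions are 0-based: position `k : Fin N` of the decreasing list `v` of values carries the
`(k+1)`-st highest value.
-/

noncomputable section

namespace Duropoly

/-! ### The recursion for prices and profits

A game is given by the decreasing list `w` of the values of its consumers and by the number `r` of
periods that are left.  Dropping the first `i` entries of `w` gives the subgame of the consumers of
the positions `i, i+1, …`.  A rule `sel` says how many units, `sel r w`, are sold in the first of
the `r` remaining periods. -/

/-- The price `p(1, ·)` offered to the consumers `w` with `r` periods left: the price that the
lowest-valued buyer of this period would be offered in the next period if she and everybody below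
her waited.  For `r = 0` (after the horizon) it is by convention the highest value, so that with one
period left it is the value of the lowest-valued buyer. -/
def offer (sel : ℕ → List ℝ → ℕ) : ℕ → List ℝ → ℝ
  | 0, w => w.headD 0
  | r + 1, w => offer sel r (w.drop (sel (r + 1) w - 1))

/-- The profit `Π(1, ·)` of the recursion from the consumers `w` with `r` periods left. -/
def profit (sel : ℕ → List ℝ → ℕ) : ℕ → List ℝ → ℝ
  | 0, _ => 0
  | r + 1, w =>
      (sel (r + 1) w : ℝ) * offer sel r (w.drop (sel (r + 1) w - 1))
        + profit sel r (w.drop (sel (r + 1) w))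

/-- Profit from selling to the top `j` consumers of `w` now, at the threat price of the last of
them, when `r` further periods follow. -/
def objective (sel : ℕ → List ℝ → ℕ) (r : ℕ) (w : List ℝ) (j : ℕ) : ℝ :=
  (j : ℝ) * offer sel r (w.drop (j - 1)) + profit sel r (w.drop j)

/-- `sel` picks a maximizer of the recursion everywhere (ties are broken arbitrarily). -/
def IsArgmaxRule (sel : ℕ → List ℝ → ℕ) : Prop :=
  ∀ (r : ℕ) (w : List ℝ), w ≠ [] →
    (1 ≤ sel (r + 1) w ∧ sel (r + 1) w ≤ w.length) ∧
    ∀ j : ℕ, 1 ≤ j → j ≤ w.length → objective sel r w j ≤ objective sel r w (sel (r + 1) w)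

/-- The static monopoly profit `max_j j * v_j`. -/
def staticProfit {N : ℕ} (v : Fin N → ℝ) : ℝ := ⨆ k : Fin N, ((k : ℕ) + 1 : ℝ) * v k

/-! ### Histories, strategies, play -/

/-- An assignment of the positions of the value list to the consumers: consumer `i` has the value
`v (θ i)`. -/
abbrev Assignment (N : ℕ) := Equiv.Perm (Fin N)

/-- A public history: the announced price and the set of buyers of every past period, the most
recent period first. -/
abbrev History (N : ℕ) := List (ℝ × Finset (Fin N))

variable {N : ℕ}

/-- The consumers who have not bought yet. -/
def remaining : History N → Finset (Fin N)
  | [] => Finset.univ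
  | e :: h => remaining h \ e.2

/-- Nobody buys twice. -/
def Feasible : History N → Prop
  | [] => True
  | e :: h => Feasible h ∧ e.2 ⊆ remaining h

/-- A pure strategy profile.  `price θ h` is the price announced after `h`, and `buy i θ h p` says
that consumer `i`, if she has not bought before, buys at the price `p` announced after `h`.  What
the players may know about the assignment `θ` is restricted by `Information` below. -/
structure Profile (N : ℕ) where
  price : Assignment N → History N → ℝ
  buy : Fin N → Assignment N → History N → ℝ → Prop

open Classical in
/-- The consumers who buy at the price `p` announced after `h`. -/
def buyers (σ : Profile N) (θ : Assignment N) (h : History N) (p : ℝ) : Finset (Fin N) :=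
  (remaining h).filter fun i => σ.buy i θ h p

/-- The history one period later, if `p` is announced after `h`. -/
def next (σ : Profile N) (θ : Assignment N) (h : History N) (p : ℝ) : History N :=
  (p, buyers σ θ h p) :: h

/-- The history reached from `h` after `r` more periods. -/
def play (σ : Profile N) (θ : Assignment N) : ℕ → History N → History N
  | 0, h => h
  | r + 1, h => play σ θ r (next σ θ h (σ.price θ h))

/-- The revenue of the duropolist. -/
def revenue (h : History N) : ℝ := (h.map fun e => e.1 * (e.2.card : ℝ)).sum

/-- The utility of consumer `i`. -/
def utility (v : Fin N → ℝ) (θ : Assignment N) (i : Fin N) (h : History N) : ℝ :=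
  (h.map fun e => if i ∈ e.2 then v (θ i) - e.1 else 0).sum

/-- The duropolist plays `d` instead. -/
def Profile.deviateSeller (σ : Profile N) (d : History N → ℝ) : Profile N where
  price := fun _ => d
  buy := σ.buy

/-- Consumer `i` plays `d` instead. -/
def Profile.deviateConsumer (σ : Profile N) (i : Fin N) (d : History N → ℝ → Prop) :
    Profile N where
  price := σ.price
  buy := Function.update σ.buy i fun _ => d

/-! ### Information, beliefs, equilibrium -/

/-- Private information: which assignments a player cannot tell apart at the outset. -/
structure Information (N : ℕ) where
  seller : Assignment N → Assignment N → Prop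
  consumer : Fin N → Assignment N → Assignment N → Prop

/-- `seller θ h` and `consumer i θ h` are the sets of the assignments that the player considers
possible after the public history `h`, when the true assignment is `θ`. -/
structure Beliefs (N : ℕ) where
  seller : Assignment N → History N → Set (Assignment N)
  consumer : Fin N → Assignment N → History N → Set (Assignment N)

/-- Subgame perfection under incomplete information: strategies and beliefs use only the player's
information, beliefs are never empty and are obtained by conditioning on the path of play, and after
every history (on or off the path) no player gains by any deviation from her continuation strategy,
in any assignment she considers possible; hence neither in expectation, whatever the
probabilities that she attaches to these. -/
structure IsPerfectEquilibrium (T : ℕ) (v : Fin N → ℝ) (I : Information N)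
    (σ : Profile N) (β : Beliefs N) : Prop where
  price_informed : ∀ θ θ' h, I.seller θ θ' → σ.price θ h = σ.price θ' h
  buy_informed : ∀ i θ θ' h p, I.consumer i θ θ' → (σ.buy i θ h p ↔ σ.buy i θ' h p)
  seller_belief_informed : ∀ θ θ' h, I.seller θ θ' → β.seller θ h = β.seller θ' h
  consumer_belief_informed : ∀ i θ θ' h, I.consumer i θ θ' → β.consumer i θ h = β.consumer i θ' h
  seller_belief_subset : ∀ θ h, ∀ θ' ∈ β.seller θ h, I.seller θ θ'
  consumer_belief_subset : ∀ i θ h, ∀ θ' ∈ β.consumer i θ h, I.consumer i θ θ'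
  seller_belief_nonempty : ∀ θ h, Feasible h → (β.seller θ h).Nonempty
  consumer_belief_nonempty : ∀ θ h, Feasible h → ∀ i ∈ remaining h, (β.consumer i θ h).Nonempty
  seller_bayes : ∀ θ θ' n, n < T →
    (θ' ∈ β.seller θ (play σ θ n []) ↔
      I.seller θ θ' ∧ play σ θ' n [] = play σ θ n [])
  consumer_bayes : ∀ θ θ' n, n < T → ∀ i ∈ remaining (play σ θ n []),
    (θ' ∈ β.consumer i θ (play σ θ n []) ↔
      I.consumer i θ θ' ∧ play σ θ' n [] = play σ θ n [])
  seller_rational : ∀ h, Feasible h → h.length < T → ∀ θ, ∀ θ' ∈ β.seller θ h,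
    ∀ d : History N → ℝ,
      revenue (play (σ.deviateSeller d) θ' (T - h.length) h)
        ≤ revenue (play σ θ' (T - h.length) h)
  consumer_rational : ∀ h, Feasible h → h.length < T → ∀ p : ℝ, ∀ i ∈ remaining h,
    ∀ θ, ∀ θ' ∈ β.consumer i θ h, ∀ d : History N → ℝ → Prop,
      utility v θ' i (play (σ.deviateConsumer i d) θ' (T - h.length - 1)
          (next (σ.deviateConsumer i d) θ' h p))
        ≤ utility v θ' i (play σ θ' (T - h.length - 1) (next σ θ' h p))

/-- The incomplete information setting: the list of values is commonly known, the duropolist has no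
further information, and a consumer knows which of the values is her own. -/
def ownValue (N : ℕ) : Information N where
  seller := fun _ _ => True
  consumer := fun i θ θ' => θ i = θ' i

/-- The duropolist knows only the list of values, the consumers know who has which value. -/
def informedConsumers (N : ℕ) : Information N where
  seller := fun _ _ => True
  consumer := fun _ θ θ' => θ = θ'

/-- Apart from the consumers in `X`, the buyers of every past period had the highest values among
those who then remained (equal values being ordered by their positions). -/
def Skimmed (X : Set (Fin N)) (θ : Assignment N) : History N → Prop
  | [] => True
  | e :: h => Skimmed X θ h ∧
      ∀ b ∈ e.2, ∀ c ∈ remaining (e :: h), b ∉ X → c ∉ X → θ b < θ c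

/-- Everybody believes that the buyers of every period were the highest-valued remaining consumers;
a consumer believes this of the others and knows her own value. -/
def skimmingBeliefs (N : ℕ) : Beliefs N where
  seller := fun _ h => {θ' | Skimmed ∅ θ' h}
  consumer := fun i θ h => {θ' | θ' i = θ i ∧ Skimmed {i} θ' h}

/-- The duropolist believes that the buyers of every period were the highest-valued remaining
consumers; the consumers know the assignment. -/
def skimmingSellerBeliefs (N : ℕ) : Beliefs N where
  seller := fun _ h => {θ' | Skimmed ∅ θ' h}
  consumer := fun _ θ _ => {θ}

/-! ### The strategies -/

/-- The price is the one that the recursion gives for the game `G θ h`, and consumer `i` buys if and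
only if the price is at most her threat price as the consumer of position `pos i θ h` in this
game; in the last period the threat price is her own value. -/
def threatProfile (T : ℕ) (sel : ℕ → List ℝ → ℕ) (v : Fin N → ℝ)
    (G : Assignment N → History N → List ℝ) (pos : Fin N → Assignment N → History N → ℕ) :
    Profile N where
  price := fun θ h => offer sel (T - h.length) (G θ h)
  buy := fun i θ h p =>
    p ≤ if h.length + 1 = T then v (θ i)
        else offer sel (T - (h.length + 1)) ((G θ h).drop (pos i θ h))

/-- The values of the consumers who actually remain, in decreasing order. -/
def actualGame (v : Fin N → ℝ) (θ : Assignment N) (h : History N) : List ℝ :=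
  (((remaining h).map θ.toEmbedding).sort (· ≤ ·)).map v

/-- The values of the consumers who are believed to remain: if `m` consumers remain, these are the
`m` lowest values. -/
def believedGame (v : Fin N → ℝ) (h : History N) : List ℝ :=
  (List.ofFn v).drop (N - (remaining h).card)

/-- The rank of consumer `i` among the consumers who actually remain. -/
def actualRank (i : Fin N) (θ : Assignment N) (h : History N) : ℕ :=
  ((remaining h).filter fun c => θ c < θ i).card

/-- The rank of consumer `i` among the remaining consumers according to her belief.  If her value is
above all those in the believed game (the truncated difference is 0), she takes herself
for the highest-valued remaining consumer. -/
def believedRank (i : Fin N) (θ : Assignment N) (h : History N) : ℕ :=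
  (θ i : ℕ) - (N - (remaining h).card)

/-- The strategies of the complete information setting. -/
def completeProfile (T : ℕ) (sel : ℕ → List ℝ → ℕ) (v : Fin N → ℝ) : Profile N :=
  threatProfile T sel v (actualGame v) actualRank

/-- The strategies of the incomplete information setting. -/
def incompleteProfile (T : ℕ) (sel : ℕ → List ℝ → ℕ) (v : Fin N → ℝ) : Profile N :=
  threatProfile T sel v (fun _ h => believedGame v h) believedRank

/-- The same strategies, with the consumers ranked by their actual values. -/
def rankedProfile (T : ℕ) (sel : ℕ → List ℝ → ℕ) (v : Fin N → ℝ) : Profile N :=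
  threatProfile T sel v (fun _ h => believedGame v h) actualRank

end Duropoly

end

/-! The prescribed game after a history is always a tail of the full list `v`, fixed by the number
of remaining consumers. So prices and profits are studied as functions `threat` and `tailProfit` of
the periods left and of the absolute position where the tail starts. Two facts about the recursion
carry the proof: threat prices decrease along the list (`threat_antitone`, an exchange argument),
and the first consumers of a tail contribute at most the opening price each (`tailProfit_le_add`).

The equilibrium argument is made once, for `rankedProfile`. If the past buyers were the top
consumers, a price that sells to `k` consumers is at most the threat price of the `k`-th, so a
period earns no more than one of the choices in the recursion (`revenue_step_le`); the prescribed
price attains the maximum (`revenue_step_eq`).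

Consumer rationality needs no skimming hypothesis. One who rightly refuses sees a strictly lower
price next (`price_lt_of_not_buy`). One who wrongly refuses is the top remaining consumer next
period, faces a price no lower than the refused one, and is then supposed to accept it
(`utility_wait_le`).

The other two profiles agree with `rankedProfile` wherever it matters. With skimmed histories all
three prescribe the same actions; and in every assignment that a remaining consumer considers
possible, believed ranks are actual ranks, even if her own past refusals broke the skimming order
(`Skimmed.believedRank_eq`). Beliefs are exact on the path because the number of buyers there does
not depend on the assignment (`card_buyers_of_skimmed`).

For the profit bound, giving up the top consumer outweighs any advantage of extra periods
(`tailProfit_succ_right_le`), and that consumer contributes at most the static price. -/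

noncomputable section

namespace Duropoly

/-! ### The recursion -/

section Recursion

variable {sel : ℕ → List ℝ → ℕ} {w : List ℝ}

/-- The price of the recursion for the consumers of the positions `a, a+1, …` of `w`. -/
def threat (sel : ℕ → List ℝ → ℕ) (w : List ℝ) (r a : ℕ) : ℝ := offer sel r (w.drop a)

/-- The profit of the recursion from the consumers of the positions `a, a+1, …` of `w`. -/
def tailProfit (sel : ℕ → List ℝ → ℕ) (w : List ℝ) (r a : ℕ) : ℝ := profit sel r (w.drop a)

theorem offer_nil (sel : ℕ → List ℝ → ℕ) (r : ℕ) : offer sel r [] = 0 := by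
  induction r with
  | zero => rfl
  | succ r ih => simpa [offer] using ih

theorem profit_nil (sel : ℕ → List ℝ → ℕ) (r : ℕ) : profit sel r [] = 0 := by
  induction r with
  | zero => rfl
  | succ r ih => simp [profit, offer_nil, ih]

theorem threat_of_length_le {r a : ℕ} (h : w.length ≤ a) : threat sel w r a = 0 := by
  rw [threat, List.drop_eq_nil_of_le h, offer_nil]

theorem tailProfit_of_length_le {r a : ℕ} (h : w.length ≤ a) : tailProfit sel w r a = 0 := by
  rw [tailProfit, List.drop_eq_nil_of_le h, profit_nil]

theorem objective_drop (sel : ℕ → List ℝ → ℕ) (w : List ℝ) (r a j : ℕ) (h : a ≤ j) :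
    objective sel r (w.drop a) (j - a + 1)
      = ((j : ℝ) - a + 1) * threat sel w r j + tailProfit sel w r (j + 1) := by
  rw [objective, threat, tailProfit, List.drop_drop, List.drop_drop]
  have h1 : a + (j - a + 1 - 1) = j := by omega
  have h2 : a + (j - a + 1) = j + 1 := by omega
  rw [h1, h2]
  push_cast [Nat.cast_sub h]
  ring

/-- The recursion in absolute positions: `j` is the last buyer of the period. With
`le_tailProfit_succ` this is all that is used of the selection rule, so ties never matter later. -/
theorem exists_lastBuyer (hsel : IsArgmaxRule sel) (r : ℕ) {a : ℕ} (ha : a < w.length) :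
    ∃ j, a ≤ j ∧ j < w.length ∧ threat sel w (r + 1) a = threat sel w r j ∧
      tailProfit sel w (r + 1) a
        = ((j : ℝ) - a + 1) * threat sel w r j + tailProfit sel w r (j + 1) := by
  have hne : w.drop a ≠ [] := by simpa using ha
  obtain ⟨⟨h1, h2⟩, -⟩ := hsel r (w.drop a) hne
  rw [List.length_drop] at h2
  refine ⟨a + (sel (r + 1) (w.drop a) - 1), by omega, by omega, ?_, ?_⟩
  · simp only [threat, offer, List.drop_drop]
  · rw [← objective_drop sel w r a _ (by omega)]
    have : a + (sel (r + 1) (w.drop a) - 1) - a + 1 = sel (r + 1) (w.drop a) := by omega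
    rw [this]
    rfl

theorem le_tailProfit_succ (hsel : IsArgmaxRule sel) (r : ℕ) {a j : ℕ} (haj : a ≤ j)
    (hj : j < w.length) :
    ((j : ℝ) - a + 1) * threat sel w r j + tailProfit sel w r (j + 1)
      ≤ tailProfit sel w (r + 1) a := by
  have hne : w.drop a ≠ [] := by
    rw [Ne, List.drop_eq_nil_iff]; omega
  rw [← objective_drop sel w r a j haj]
  refine ((hsel r (w.drop a) hne).2 _ (by omega) ?_).trans_eq rfl
  rw [List.length_drop]
  omega

variable (hsel : IsArgmaxRule sel) (hw : Antitone fun a => (w.drop a).headD 0)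
include hsel hw

/-- The hypothesis `hw` encodes both that the values decrease and that they are nonnegative, the
default 0 standing beyond the end of the list. If the last buyer moves down with the start of the
tail, induction applies; otherwise the two choices are exchanged. -/
theorem threat_antitone (r : ℕ) : Antitone (threat sel w r) := by
  induction r with
  | zero => exact hw
  | succ r ih =>
    have nonneg (s : ℕ) (h : Antitone (threat sel w s)) (a : ℕ) : 0 ≤ threat sel w s a := by
      rw [← threat_of_length_le (sel := sel) (r := s) (le_max_right a w.length)]
      exact h (le_max_left _ _)
    intro a b hab
    rcases le_or_gt w.length b with hb | hb
    · rw [threat_of_length_le hb]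
      rcases le_or_gt w.length a with ha | ha
      · rw [threat_of_length_le ha]
      · obtain ⟨j, -, -, h, -⟩ := exists_lastBuyer hsel r ha
        rw [h]
        exact nonneg r ih j
    · obtain ⟨j, haj, hj, h, hp⟩ := exists_lastBuyer hsel r (hab.trans_lt hb)
      obtain ⟨k, hbk, hk, h', hp'⟩ := exists_lastBuyer hsel r hb
      rw [h, h']
      rcases le_or_gt j k with hjk | hkj
      · exact ih hjk
      -- Each of `j`, `k` is feasible from the other start. Adding the two optimality inequalities
      -- cancels everything but `b - a` times the difference of the two prices.
      · have h1 := le_tailProfit_succ hsel r (hab.trans hbk) hk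
        have h2 := le_tailProfit_succ hsel r (hbk.trans hkj.le) hj
        rw [hp] at h1
        rw [hp'] at h2
        rcases hab.eq_or_lt with rfl | hab
        · rw [← h, ← h']
        · have : (a : ℝ) < b := by exact_mod_cast hab
          nlinarith

theorem threat_nonneg (r a : ℕ) : 0 ≤ threat sel w r a := by
  rw [← threat_of_length_le (sel := sel) (r := r) (le_max_right a w.length)]
  exact threat_antitone hsel hw r (le_max_left _ _)

theorem threat_succ_le (r a : ℕ) : threat sel w (r + 1) a ≤ threat sel w r a := by
  rcases le_or_gt w.length a with ha | ha
  · rw [threat_of_length_le ha, threat_of_length_le ha]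
  · obtain ⟨j, haj, -, h, -⟩ := exists_lastBuyer hsel r ha
    rw [h]
    exact threat_antitone hsel hw r haj

theorem threat_anti_left (a : ℕ) : Antitone fun r => threat sel w r a :=
  antitone_nat_of_succ_le fun r => threat_succ_le hsel hw r a

/-- Prices paid by the consumers of positions `a` to `b - 1` never exceed the opening price, and an
optimal plan cut at `b` is available to the tail that starts there. -/
theorem tailProfit_le_add (r : ℕ) : ∀ {a b : ℕ}, a ≤ b → b ≤ w.length →
    tailProfit sel w r a ≤ ((b : ℝ) - a) * threat sel w r a + tailProfit sel w r b := by
  induction r with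
  | zero =>
    intro a b hab _
    have h1 : (a : ℝ) ≤ b := by exact_mod_cast hab
    have h2 := mul_nonneg (sub_nonneg.2 h1) (threat_nonneg hsel hw 0 a)
    have h3 (c : ℕ) : tailProfit sel w 0 c = 0 := rfl
    rw [h3, h3]
    linarith
  | succ r ih =>
    -- The case of one consumer with `r` periods says that an extra period does no harm: it can be
    -- spent on selling to the top consumer alone.
    have mono {c : ℕ} : tailProfit sel w r c ≤ tailProfit sel w (r + 1) c := by
      rcases le_or_gt w.length c with hc | hc
      · rw [tailProfit_of_length_le hc, tailProfit_of_length_le hc]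
      · have h1 := ih (Nat.le_succ c) hc
        have h2 := le_tailProfit_succ hsel r le_rfl hc
        push_cast at h1
        linarith
    intro a b hab hb
    induction hn : b - a using Nat.strong_induction_on generalizing a with
    | _ n ihn =>
      rcases hab.eq_or_lt with rfl | hlt
      · simp
      obtain ⟨j, haj, hj, h, hp⟩ := exists_lastBuyer hsel r (hlt.trans_le hb)
      rw [hp, h]
      rcases le_or_gt b j with hbj | hjb
      · have := le_tailProfit_succ hsel r hbj hj
        linarith
      · have h1 := ihn (b - (j + 1)) (by omega) (a := j + 1) hjb rfl
        have h2 := threat_antitone hsel hw (r + 1) (haj.trans (Nat.le_succ j))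
        have h3 := @mono (j + 1)
        have h4 : ((j + 1 : ℕ) : ℝ) ≤ b := by exact_mod_cast hjb
        rw [h] at h2
        have h5 := mul_le_mul_of_nonneg_left h2 (sub_nonneg.2 h4)
        push_cast at h1 h5
        linarith

theorem tailProfit_succ_le (r a : ℕ) : tailProfit sel w r a ≤ tailProfit sel w (r + 1) a := by
  rcases le_or_gt w.length a with hc | hc
  · rw [tailProfit_of_length_le hc, tailProfit_of_length_le hc]
  · have h1 := tailProfit_le_add hsel hw r (Nat.le_succ a) hc
    have h2 := le_tailProfit_succ hsel r le_rfl hc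
    push_cast at h1
    linarith

theorem tailProfit_mono_left (a : ℕ) : Monotone fun r => tailProfit sel w r a :=
  monotone_nat_of_le_succ fun r => tailProfit_succ_le hsel hw r a

/-- Let `j` be the last buyer in the first period. By induction the later sales earn at most the
static profit from `j` on, attained at the price of some `m`. The earlier buyers pay at most that
price too, so the total is covered by a static sale from `a` to `m`, the overlap at `j` being paid
for by the extra consumer `a`. -/
theorem tailProfit_succ_right_le (r : ℕ) {a : ℕ} (ha : a < w.length) :
    tailProfit sel w r (a + 1) ≤ tailProfit sel w 1 a := by
  induction r generalizing a with
  | zero =>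
    refine le_trans ?_ (tailProfit_mono_left hsel hw a zero_le_one)
    exact le_rfl
  | succ r ih =>
    rcases le_or_gt w.length (a + 1) with h | h
    · rw [tailProfit_of_length_le h]
      exact tailProfit_mono_left hsel hw a zero_le_one
    · obtain ⟨j, haj, hj, -, hp⟩ := exists_lastBuyer hsel r h
      obtain ⟨m, hjm, hm, h1, hp1⟩ := exists_lastBuyer hsel 0 hj
      have h2 := le_tailProfit_succ hsel 0 (show a ≤ m by omega) hm
      have h3 := ih hj
      have h0 (c : ℕ) : tailProfit sel w 0 c = 0 := rfl
      have h5 : ((a + 1 : ℕ) : ℝ) ≤ j := by exact_mod_cast haj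
      rw [h0] at h2 hp1
      rw [hp]
      -- For `r = 0` the threat price of `j` is her value, which may exceed the static price from
      -- `j` on; but then there are no later sales.
      rcases Nat.eq_zero_or_pos r with rfl | hr
      · have := le_tailProfit_succ hsel 0 (show a ≤ j by omega) hj
        have := threat_nonneg hsel hw 0 j
        rw [h0] at *
        push_cast at *
        linarith
      · have h4 : threat sel w r j ≤ threat sel w 0 m :=
          (threat_anti_left hsel hw j hr).trans_eq h1
        push_cast at h5 ⊢
        have := mul_le_mul_of_nonneg_left h4 (show (0 : ℝ) ≤ j - (a + 1) + 1 by linarith)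
        linarith

/-- With `r ≥ 1` periods, the profit exceeds the static profit by at most the static
price. -/
theorem tailProfit_le_static_add {r : ℕ} (hr : 1 ≤ r) (a : ℕ) :
    tailProfit sel w r a ≤ tailProfit sel w 1 a + threat sel w 1 a := by
  rcases le_or_gt w.length a with ha | ha
  · rw [tailProfit_of_length_le ha, tailProfit_of_length_le ha, threat_of_length_le ha, add_zero]
  · have h1 := tailProfit_le_add hsel hw r (Nat.le_succ a) ha
    have h2 := tailProfit_succ_right_le hsel hw r ha
    have h3 := threat_anti_left hsel hw a hr
    push_cast at h1
    dsimp at h3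
    linarith

end Recursion

variable {N : ℕ}

/-! ### The list of values -/

theorem headD_drop_ofFn (v : Fin N → ℝ) (a : ℕ) :
    ((List.ofFn v).drop a).headD 0 = if h : a < N then v ⟨a, h⟩ else 0 := by
  rw [List.headD_eq_head?_getD, List.head?_drop]
  split_ifs with h <;> simp [h]

theorem antitone_headD_drop_ofFn {v : Fin N → ℝ} (hv : Antitone v) (hv0 : ∀ k, 0 ≤ v k) :
    Antitone fun a => ((List.ofFn v).drop a).headD 0 := by
  intro a b hab
  simp only [headD_drop_ofFn]
  split_ifs with hb ha
  · exact hv hab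
  · omega
  · exact hv0 _
  · exact le_rfl

theorem threat_zero_ofFn (sel : ℕ → List ℝ → ℕ) (v : Fin N → ℝ) (k : Fin N) :
    threat sel (List.ofFn v) 0 k = v k := by
  change ((List.ofFn v).drop k).headD 0 = v k
  rw [headD_drop_ofFn, dif_pos k.2]

/-! ### Histories and ranks -/

theorem remaining_cons_subset (e : ℝ × Finset (Fin N)) (h : History N) :
    remaining (e :: h) ⊆ remaining h := Finset.sdiff_subset

theorem card_remaining_le (h : History N) : (remaining h).card ≤ N := by
  simpa using (remaining h).card_le_univ

theorem sub_card_remaining_cons {e : ℝ × Finset (Fin N)} {h : History N}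
    (he : e.2 ⊆ remaining h) :
    N - (remaining (e :: h)).card = N - (remaining h).card + e.2.card := by
  have h1 : (remaining (e :: h)).card = (remaining h).card - e.2.card := Finset.card_sdiff_of_subset he
  have h2 := Finset.card_le_card he
  have h3 := card_remaining_le h
  omega

theorem buyers_subset (σ : Profile N) (θ : Assignment N) (h : History N) (p : ℝ) :
    buyers σ θ h p ⊆ remaining h := by
  classical
  exact Finset.filter_subset _ _

theorem mem_buyers {σ : Profile N} {θ : Assignment N} {h : History N} {p : ℝ} {c : Fin N} :
    c ∈ buyers σ θ h p ↔ c ∈ remaining h ∧ σ.buy c θ h p := by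
  classical
  simp [buyers]

theorem play_succ (σ : Profile N) (θ : Assignment N) (n : ℕ) (h : History N) :
    play σ θ (n + 1) h = next σ θ (play σ θ n h) (σ.price θ (play σ θ n h)) := by
  induction n generalizing h with
  | zero => rfl
  | succ n ih => rw [play, ih]; rfl

theorem revenue_cons (e : ℝ × Finset (Fin N)) (h : History N) :
    revenue (e :: h) = e.1 * (e.2.card : ℝ) + revenue h := by
  simp [revenue]

theorem utility_cons (v : Fin N → ℝ) (θ : Assignment N) (i : Fin N)
    (e : ℝ × Finset (Fin N)) (h : History N) :
    utility v θ i (e :: h) = (if i ∈ e.2 then v (θ i) - e.1 else 0) + utility v θ i h := by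
  simp [utility]

theorem utility_of_mem_remaining (v : Fin N → ℝ) (θ : Assignment N) {i : Fin N} {h : History N}
    (hi : i ∈ remaining h) : utility v θ i h = 0 := by
  induction h with
  | nil => rfl
  | cons e h ih =>
    have := Finset.mem_sdiff.1 hi
    rw [utility_cons, if_neg this.2, ih this.1, add_zero]

theorem utility_play_of_notMem (v : Fin N → ℝ) (σ : Profile N) (θ : Assignment N) {i : Fin N}
    (n : ℕ) {h : History N} (hi : i ∉ remaining h) :
    utility v θ i (play σ θ n h) = utility v θ i h := by
  induction n generalizing h with
  | zero => rfl
  | succ n ih =>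
    rw [play, next, ih fun hm => hi (remaining_cons_subset _ _ hm), utility_cons,
      if_neg fun hm => hi (buyers_subset _ _ _ _ hm), zero_add]

theorem notMem_remaining_cons {i : Fin N} {e : ℝ × Finset (Fin N)} {h : History N}
    (hi : i ∈ e.2) : i ∉ remaining (e :: h) := fun hm => (Finset.mem_sdiff.1 hm).2 hi

/-- A consumer who buys now gets her value minus the price. -/
theorem utility_play_next_of_buy (v : Fin N → ℝ) (σ : Profile N) (θ : Assignment N) {i : Fin N}
    (n : ℕ) {h : History N} {p : ℝ} (hi : i ∈ remaining h) (hb : σ.buy i θ h p) :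
    utility v θ i (play σ θ n (next σ θ h p)) = v (θ i) - p := by
  have hm : i ∈ buyers σ θ h p := mem_buyers.2 ⟨hi, hb⟩
  rw [next, utility_play_of_notMem v σ θ n (notMem_remaining_cons hm), utility_cons, if_pos hm,
    utility_of_mem_remaining v θ hi, add_zero]

theorem actualRank_mono {θ : Assignment N} {h : History N} {b c : Fin N} (hbc : θ b ≤ θ c) :
    actualRank b θ h ≤ actualRank c θ h :=
  Finset.card_le_card <| Finset.monotone_filter_right _ fun _ _ hx => lt_of_lt_of_le hx hbc

/-- The position of consumer `i` in the believed game, if she has her actual rank in it. -/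
def standing (i : Fin N) (θ : Assignment N) (h : History N) : ℕ :=
  N - (remaining h).card + actualRank i θ h

theorem standing_mono {θ : Assignment N} {h : History N} {b c : Fin N} (hbc : θ b ≤ θ c) :
    standing b θ h ≤ standing c θ h := Nat.add_le_add_left (actualRank_mono hbc) _

theorem card_filter_lt (θ : Assignment N) (i : Fin N) :
    (Finset.univ.filter fun c => θ c < θ i).card = θ i := by
  have : (Finset.univ.filter fun c => θ c < θ i).map θ.toEmbedding = Finset.Iio (θ i) := by
    ext k
    simp only [Finset.mem_map_equiv, Finset.mem_filter, Finset.mem_univ, true_and,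
      Equiv.apply_symm_apply, Finset.mem_Iio]
  rw [← Finset.card_map, this, Fin.card_Iio]

theorem card_filter_lt_eq (θ : Assignment N) (h : History N) (i : Fin N) :
    (θ i : ℕ) = ((remaining h)ᶜ.filter fun c => θ c < θ i).card + actualRank i θ h := by
  rw [actualRank, ← card_filter_lt θ i, ← Finset.card_union_of_disjoint, ← Finset.filter_union,
    Finset.union_comm, Finset.union_compl]
  exact Finset.disjoint_filter_filter (disjoint_compl_left)

theorem card_compl_remaining (h : History N) :
    ((remaining h)ᶜ).card = N - (remaining h).card := by
  rw [Finset.card_compl, Fintype.card_fin]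

/-- Departed consumers below `i` only push her down in the believed game, so her true value is at
least the one listed at her standing, whatever the history. -/
theorem le_standing (θ : Assignment N) (h : History N) (i : Fin N) :
    (θ i : ℕ) ≤ standing i θ h := by
  rw [card_filter_lt_eq θ h i, standing, ← card_compl_remaining]
  exact Nat.add_le_add_right (Finset.card_filter_le _ _) _

theorem eq_standing {θ : Assignment N} {h : History N} {i : Fin N}
    (hb : ∀ b ∉ remaining h, θ b < θ i) : (θ i : ℕ) = standing i θ h := by
  conv_lhs => rw [card_filter_lt_eq θ h i]
  rw [standing, ← card_compl_remaining, Finset.filter_true_of_mem]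
  simpa using hb

/-- Some remaining consumer outside `B` has at most `B.card` higher-valued ones above her. -/
theorem exists_notMem_standing_le {θ : Assignment N} {h : History N} {B : Finset (Fin N)}
    {i : Fin N} (hi : i ∈ remaining h) (hiB : i ∉ B) :
    ∃ c ∈ remaining h, c ∉ B ∧ standing c θ h ≤ N - (remaining h).card + B.card := by
  obtain ⟨c, hc, hmin⟩ := (remaining h \ B).exists_min_image θ ⟨i, Finset.mem_sdiff.2 ⟨hi, hiB⟩⟩
  obtain ⟨hc1, hc2⟩ := Finset.mem_sdiff.1 hc
  refine ⟨c, hc1, hc2, Nat.add_le_add_left (Finset.card_le_card fun x hx => ?_) _⟩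
  obtain ⟨hx1, hx2⟩ := Finset.mem_filter.1 hx
  by_contra hxB
  exact (hmin x (Finset.mem_sdiff.2 ⟨hx1, hxB⟩)).not_gt hx2

/-- The last member of a set `B` of remaining consumers has all the others of `B` above her. -/
theorem exists_mem_le_standing {θ : Assignment N} {h : History N} {B : Finset (Fin N)}
    (hB : B ⊆ remaining h) (hne : B.Nonempty) :
    ∃ b ∈ B, N - (remaining h).card + (B.card - 1) ≤ standing b θ h := by
  obtain ⟨b, hb, hmax⟩ := B.exists_max_image θ hne
  refine ⟨b, hb, Nat.add_le_add_left ?_ _⟩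
  rw [← Finset.card_erase_of_mem hb]
  refine Finset.card_le_card fun x hx => ?_
  obtain ⟨hxb, hxB⟩ := Finset.mem_erase.1 hx
  exact Finset.mem_filter.2
    ⟨hB hxB, lt_of_le_of_ne (hmax x hxB) fun he => hxb (θ.injective he)⟩

/-! ### Skimming -/

theorem skimmed_nil (X : Set (Fin N)) (θ : Assignment N) : Skimmed X θ [] := trivial

theorem Skimmed.mono {X Y : Set (Fin N)} (hXY : X ⊆ Y) {θ : Assignment N} {h : History N}
    (hs : Skimmed X θ h) : Skimmed Y θ h := by
  induction h with
  | nil => trivial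
  | cons e h ih =>
    exact ⟨ih hs.1, fun b hb c hc hbY hcY =>
      hs.2 b hb c hc (fun hx => hbY (hXY hx)) fun hx => hcY (hXY hx)⟩

theorem Skimmed.lt {X : Set (Fin N)} {θ : Assignment N} {h : History N} (hs : Skimmed X θ h)
    {b c : Fin N} (hb : b ∉ remaining h) (hc : c ∈ remaining h) (hbX : b ∉ X) (hcX : c ∉ X) :
    θ b < θ c := by
  induction h with
  | nil => exact absurd (Finset.mem_univ b) hb
  | cons e h ih =>
    by_cases hbe : b ∈ e.2
    · exact hs.2 b hbe c hc hbX hcX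
    · exact ih hs.1 (fun hm => hb (Finset.mem_sdiff.2 ⟨hm, hbe⟩)) (remaining_cons_subset _ _ hc)

theorem Skimmed.eq_standing {θ : Assignment N} {h : History N} (hs : Skimmed ∅ θ h) {c : Fin N}
    (hc : c ∈ remaining h) : (θ c : ℕ) = standing c θ h :=
  Duropoly.eq_standing fun _ hb => hs.lt hb hc (Set.notMem_empty _) (Set.notMem_empty _)

/-- Only `i` herself may be out of order. For the others the departed are exactly on top. -/
theorem Skimmed.believedRank_eq {i : Fin N} {θ : Assignment N} {h : History N}
    (hs : Skimmed {i} θ h) (hi : i ∈ remaining h) {c : Fin N} (hc : c ∈ remaining h) :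
    believedRank c θ h = actualRank c θ h := by
  have ne {b : Fin N} (hb : b ∉ remaining h) : b ∉ ({i} : Set (Fin N)) := by
    rintro rfl
    exact hb hi
  have key : (θ c : ℕ) = standing c θ h → believedRank c θ h = actualRank c θ h := fun he => by
    rw [believedRank, he, standing, Nat.add_sub_cancel_left]
  by_cases hci : c = i
  · subst hci
    -- A remaining consumer above `i` lies below all departed ones, so `i` is in order too. Without
    -- such a consumer her actual rank is 0, and the truncated subtraction also gives 0.
    by_cases hex : ∃ x ∈ remaining h, θ x < θ c
    · obtain ⟨x, hx, hxc⟩ := hex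
      refine key (Duropoly.eq_standing fun b hb => (hs.lt hb hx (ne hb) ?_).trans hxc)
      rintro rfl
      exact hxc.false
    · have h0 : actualRank c θ h = 0 := by
        rw [actualRank, Finset.card_eq_zero, Finset.filter_eq_empty_iff]
        exact fun x hx hlt => hex ⟨x, hx, hlt⟩
      have := le_standing θ h c
      rw [standing, h0] at this
      rw [h0, believedRank]
      omega
  · exact key (Duropoly.eq_standing fun b hb => hs.lt hb hc (ne hb) hci)

theorem Skimmed.believedRank_eq_of_empty {θ : Assignment N} {h : History N}
    (hs : Skimmed ∅ θ h) {c : Fin N} (hc : c ∈ remaining h) :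
    believedRank c θ h = actualRank c θ h :=
  (hs.mono (Set.empty_subset {c})).believedRank_eq hc hc

theorem Skimmed.mem_remaining_iff {θ : Assignment N} {h : History N} (hs : Skimmed ∅ θ h)
    {c : Fin N} : c ∈ remaining h ↔ N - (remaining h).card ≤ θ c := by
  constructor
  · intro hc
    rw [hs.eq_standing hc]
    exact Nat.le_add_right _ _
  · intro hle
    by_contra hc
    have h1 : ((Finset.univ.filter fun x => θ x < θ c)).card < ((remaining h)ᶜ).card := by
      refine Finset.card_lt_card ((Finset.ssubset_iff_of_subset ?_).2 ⟨c, ?_, ?_⟩)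
      · intro x hx
        rw [Finset.mem_compl]
        exact fun hxr => ((hs.lt hc hxr (Set.notMem_empty _) (Set.notMem_empty _)).trans
          (Finset.mem_filter.1 hx).2).false
      · exact Finset.mem_compl.2 hc
      · simp
    rw [card_filter_lt, card_compl_remaining] at h1
    omega

theorem Skimmed.next {X : Set (Fin N)} {σ : Profile N} {θ : Assignment N} {h : History N} {p : ℝ}
    (hs : Skimmed X θ h)
    (hσ : ∀ b ∉ X, ∀ c ∉ X, θ c ≤ θ b → σ.buy b θ h p → σ.buy c θ h p) :
    Skimmed X θ (next σ θ h p) := by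
  refine ⟨hs, fun b hb c hc hbX hcX => lt_of_not_ge fun hle => ?_⟩
  obtain ⟨hc1, hc2⟩ := Finset.mem_sdiff.1 hc
  exact hc2 (mem_buyers.2 ⟨hc1, hσ b hbX c hcX hle (mem_buyers.1 hb).2⟩)

/-- The length of time for which a consumer has been observed to wait. -/
def waiting : History N → Fin N → ℕ
  | [], _ => 0
  | e :: h, c => waiting h c + if c ∈ remaining (e :: h) then 1 else 0

theorem waiting_le (h : History N) (c : Fin N) : waiting h c ≤ h.length := by
  induction h with
  | nil => exact le_rfl
  | cons e h ih =>
    rw [waiting, List.length_cons]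
    split_ifs <;> omega

theorem waiting_of_mem {h : History N} {c : Fin N} (hc : c ∈ remaining h) :
    waiting h c = h.length := by
  induction h with
  | nil => rfl
  | cons e h ih =>
    rw [waiting, if_pos hc, ih (remaining_cons_subset _ _ hc), List.length_cons]

theorem waiting_lt_of_notMem {h : History N} {c : Fin N} (hc : c ∉ remaining h) :
    waiting h c < h.length := by
  cases h with
  | nil => exact absurd (Finset.mem_univ c) hc
  | cons e h =>
    rw [waiting, if_neg hc, List.length_cons]
    exact Nat.lt_succ_of_le (waiting_le h c)

theorem skimmed_of_waiting {X : Set (Fin N)} {θ : Assignment N} {h : History N}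
    (hθ : ∀ b ∉ X, ∀ c ∉ X, waiting h b < waiting h c → θ b < θ c) : Skimmed X θ h := by
  induction h with
  | nil => trivial
  | cons e h ih =>
    refine ⟨ih fun b hb c hc hlt => hθ b hb c hc ?_, fun b hb c hc hbX hcX => hθ b hbX c hcX ?_⟩
    -- The new period cannot reverse an order: only consumers who have waited throughout gain from
    -- it.
    · by_cases hcr : c ∈ remaining (e :: h)
      · simp only [waiting, if_pos hcr]
        split_ifs <;> omega
      · by_cases hbr : b ∈ remaining (e :: h)
        · rw [waiting_of_mem (remaining_cons_subset _ _ hbr)] at hlt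
          exact absurd (waiting_le h c) hlt.not_ge
        · simpa only [waiting, if_neg hcr, if_neg hbr, add_zero] using hlt
    · rw [waiting_of_mem hc]
      exact waiting_lt_of_notMem (notMem_remaining_cons hb)

/-- Sorting the consumers by waiting time puts earlier buyers higher. -/
theorem exists_skimmed (h : History N) :
    ∃ θ : Assignment N, ∀ b c, waiting h b < waiting h c → θ b < θ c := by
  refine ⟨(Tuple.sort (waiting h)).symm, fun b c hlt => lt_of_not_ge fun hle => ?_⟩
  have := Tuple.monotone_sort (waiting h) hle
  simp only [Function.comp_apply, Equiv.apply_symm_apply] at this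
  exact this.not_gt hlt

theorem exists_skimmed_apply_eq (h : History N) (i k : Fin N) :
    ∃ θ : Assignment N, θ i = k ∧ Skimmed {i} θ h := by
  obtain ⟨θ, hθ⟩ := exists_skimmed h
  obtain _ | n := N
  · exact i.elim0
  -- Move `i` to position `k` and keep the relative order of all others.
  refine ⟨θ.trans ((finSuccEquiv' (θ i)).trans (finSuccEquiv' k).symm), ?_,
    skimmed_of_waiting fun b hb c hc hlt => ?_⟩
  · simp
  · have hlt' := hθ b c hlt
    obtain ⟨x, hx⟩ := Fin.exists_succAbove_eq (show θ b ≠ θ i from fun he => hb (θ.injective he))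
    obtain ⟨y, hy⟩ := Fin.exists_succAbove_eq (show θ c ≠ θ i from fun he => hc (θ.injective he))
    rw [← hx, ← hy, (Fin.strictMono_succAbove (θ i)).lt_iff_lt] at hlt'
    simp only [Equiv.trans_apply, ← hx, ← hy, finSuccEquiv'_succAbove, finSuccEquiv'_symm_some]
    exact (Fin.strictMono_succAbove k) hlt'

/-! ### Plays of related profiles -/

/-- Two profiles prescribe the same actions after `h`. -/
def AgreeAt (σ σ' : Profile N) (θ : Assignment N) (h : History N) : Prop :=
  σ.price θ h = σ'.price θ h ∧ ∀ c ∈ remaining h, ∀ p, σ.buy c θ h p ↔ σ'.buy c θ h p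

theorem AgreeAt.next_eq {σ σ' : Profile N} {θ : Assignment N} {h : History N}
    (hh : AgreeAt σ σ' θ h) (p : ℝ) : next σ θ h p = next σ' θ h p := by
  rw [next, next]
  congr 2
  ext c
  rw [mem_buyers, mem_buyers]
  exact and_congr_right fun hc => hh.2 c hc p

theorem AgreeAt.deviateSeller {σ σ' : Profile N} {θ : Assignment N} {h : History N}
    (hh : AgreeAt σ σ' θ h) (d : History N → ℝ) :
    AgreeAt (σ.deviateSeller d) (σ'.deviateSeller d) θ h := ⟨rfl, hh.2⟩

theorem deviateConsumer_buy_self (σ : Profile N) (i : Fin N) (d : History N → ℝ → Prop)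
    (θ : Assignment N) (h : History N) (p : ℝ) :
    (σ.deviateConsumer i d).buy i θ h p = d h p := by
  simp [Profile.deviateConsumer]

theorem deviateConsumer_buy_of_ne (σ : Profile N) {i c : Fin N} (hc : c ≠ i)
    (d : History N → ℝ → Prop) (θ : Assignment N) (h : History N) (p : ℝ) :
    (σ.deviateConsumer i d).buy c θ h p = σ.buy c θ h p := by
  simp [Profile.deviateConsumer, hc]

theorem AgreeAt.deviateConsumer {σ σ' : Profile N} {θ : Assignment N} {h : History N}
    (hh : AgreeAt σ σ' θ h) (i : Fin N) (d : History N → ℝ → Prop) :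
    AgreeAt (σ.deviateConsumer i d) (σ'.deviateConsumer i d) θ h := by
  refine ⟨hh.1, fun c hc p => ?_⟩
  by_cases hci : c = i
  · subst hci
    rw [deviateConsumer_buy_self, deviateConsumer_buy_self]
  · rw [deviateConsumer_buy_of_ne σ hci, deviateConsumer_buy_of_ne σ' hci]
    exact hh.2 c hc p

theorem erase_buyers_deviateConsumer {σ : Profile N} {θ : Assignment N} {h : History N} {p : ℝ}
    {i : Fin N} {d : History N → ℝ → Prop} :
    (buyers (σ.deviateConsumer i d) θ h p).erase i = (buyers σ θ h p).erase i := by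
  ext c
  simp only [Finset.mem_erase, mem_buyers]
  refine and_congr_right fun hc => ?_
  rw [deviateConsumer_buy_of_ne σ hc]

theorem next_of_not_buy {σ : Profile N} {θ : Assignment N} {h : History N} {p : ℝ}
    {i : Fin N} (hb : ¬ σ.buy i θ h p) : next σ θ h p = (p, (buyers σ θ h p).erase i) :: h := by
  rw [next, Finset.erase_eq_of_notMem fun hm => hb (mem_buyers.1 hm).2]

theorem mem_remaining_erase {h : History N} {i : Fin N} (hi : i ∈ remaining h) (p : ℝ)
    (B : Finset (Fin N)) : i ∈ remaining ((p, B.erase i) :: h) :=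
  Finset.mem_sdiff.2 ⟨hi, Finset.notMem_erase i B⟩

theorem play_congr {σ σ' : Profile N} {θ : Assignment N} {Inv : History N → Prop}
    (hσ : ∀ h, Inv h → AgreeAt σ σ' θ h) (hI : ∀ h p, Inv h → Inv (next σ' θ h p))
    (n : ℕ) {h : History N} (hh : Inv h) : play σ θ n h = play σ' θ n h := by
  induction n generalizing h with
  | zero => rfl
  | succ n ih =>
    rw [play, play, (hσ h hh).next_eq, (hσ h hh).1]
    exact ih (hI _ _ hh)

/-- Agreement is needed only until `i` buys: her utility is then settled, while the profiles may
part once her out-of-order purchase has made believed ranks wrong. -/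
theorem utility_play_congr {σ σ' : Profile N} {θ : Assignment N} {Inv : History N → Prop}
    {i : Fin N} (hσ : ∀ h, Inv h → i ∈ remaining h → AgreeAt σ σ' θ h)
    (hI : ∀ h p, Inv h → Inv (next σ' θ h p)) (v : Fin N → ℝ) (n : ℕ) {h : History N}
    (hh : Inv h) : utility v θ i (play σ θ n h) = utility v θ i (play σ' θ n h) := by
  induction n generalizing h with
  | zero => rfl
  | succ n ih =>
    by_cases hi : i ∈ remaining h
    · rw [play, play, (hσ h hh hi).next_eq, (hσ h hh hi).1]
      exact ih (hI _ _ hh)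
    · rw [utility_play_of_notMem _ _ _ _ hi, utility_play_of_notMem _ _ _ _ hi]

/-! ### The ranked profile -/

section Ranked

variable {T : ℕ} {sel : ℕ → List ℝ → ℕ} {v : Fin N → ℝ}

theorem ranked_price (T : ℕ) (sel : ℕ → List ℝ → ℕ) (v : Fin N → ℝ) (θ : Assignment N)
    (h : History N) : (rankedProfile T sel v).price θ h
      = threat sel (List.ofFn v) (T - h.length) (N - (remaining h).card) := rfl

theorem ranked_buy_last {θ : Assignment N} {h : History N} (hT : h.length + 1 = T) (c : Fin N)
    (p : ℝ) : (rankedProfile T sel v).buy c θ h p ↔ p ≤ v (θ c) := by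
  simp [rankedProfile, threatProfile, hT]

theorem ranked_buy {θ : Assignment N} {h : History N} (hT : h.length + 1 ≠ T) (c : Fin N)
    (p : ℝ) : (rankedProfile T sel v).buy c θ h p
      ↔ p ≤ threat sel (List.ofFn v) (T - (h.length + 1)) (standing c θ h) := by
  simp only [rankedProfile, threatProfile, if_neg hT, threat, standing, believedGame,
    List.drop_drop]

/-- After a skimmed history standing and true position coincide, which absorbs the last period into
the general rule, as the threat price with no periods left is the value. -/
theorem ranked_buy_of_skimmed {θ : Assignment N} {h : History N} (hs : Skimmed ∅ θ h)
    {c : Fin N} (hc : c ∈ remaining h) (p : ℝ) : (rankedProfile T sel v).buy c θ h p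
      ↔ p ≤ threat sel (List.ofFn v) (T - (h.length + 1)) (θ c) := by
  by_cases hT : h.length + 1 = T
  · rw [ranked_buy_last hT, hT, Nat.sub_self, threat_zero_ofFn]
  · rw [ranked_buy hT, hs.eq_standing hc]

theorem agreeAt_incomplete {θ : Assignment N} {h : History N}
    (hr : ∀ c ∈ remaining h, believedRank c θ h = actualRank c θ h) :
    AgreeAt (incompleteProfile T sel v) (rankedProfile T sel v) θ h := by
  refine ⟨rfl, fun c hc p => ?_⟩
  simp only [incompleteProfile, rankedProfile, threatProfile, hr c hc]

theorem actualGame_of_skimmed {θ : Assignment N} {h : History N} (hs : Skimmed ∅ θ h) :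
    actualGame v θ h = believedGame v h := by
  have h1 : ((remaining h).map θ.toEmbedding).sort (· ≤ ·)
      = (List.finRange N).drop (N - (remaining h).card) := by
    refine List.Perm.eq_of_pairwise (le := (· ≤ ·)) (fun _ _ _ _ => le_antisymm)
      (Finset.pairwise_sort _ _) ?_ ?_
    · exact ((List.pairwise_le_finRange N).sublist (List.drop_sublist _ _))
    · rw [List.perm_ext_iff_of_nodup (Finset.sort_nodup _ _)
        ((List.nodup_finRange N).sublist (List.drop_sublist _ _))]
      intro k
      rw [Finset.mem_sort, Finset.mem_map_equiv, hs.mem_remaining_iff, Equiv.apply_symm_apply,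
        List.mem_drop_iff_getElem]
      constructor
      · intro hk
        exact ⟨k - (N - (remaining h).card), by simp; omega, Fin.ext (by simp; omega)⟩
      · rintro ⟨j, hj, rfl⟩
        simp
  rw [actualGame, believedGame, h1, List.map_drop, List.ofFn_eq_map]

theorem agreeAt_complete {θ : Assignment N} {h : History N} (hs : Skimmed ∅ θ h) :
    AgreeAt (completeProfile T sel v) (rankedProfile T sel v) θ h := by
  refine ⟨?_, fun c _ p => ?_⟩
  · simp only [completeProfile, rankedProfile, threatProfile, actualGame_of_skimmed hs]
  · simp only [completeProfile, rankedProfile, threatProfile, actualGame_of_skimmed hs]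

variable (hsel : IsArgmaxRule sel) (hv : Antitone v) (hv0 : ∀ k, 0 ≤ v k)
include hsel hv hv0

theorem ranked_buy_mono {θ : Assignment N} {h : History N} {p : ℝ} {b c : Fin N}
    (hcb : θ c ≤ θ b) (hb : (rankedProfile T sel v).buy b θ h p) :
    (rankedProfile T sel v).buy c θ h p := by
  by_cases hT : h.length + 1 = T
  · rw [ranked_buy_last hT] at hb ⊢
    exact hb.trans (hv hcb)
  · rw [ranked_buy hT] at hb ⊢
    exact hb.trans
      (threat_antitone hsel (antitone_headD_drop_ofFn hv hv0) _ (standing_mono hcb))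

theorem Skimmed.next_ranked {X : Set (Fin N)} {θ : Assignment N} {h : History N}
    (hs : Skimmed X θ h) (p : ℝ) : Skimmed X θ (Duropoly.next (rankedProfile T sel v) θ h p) :=
  hs.next fun _ _ _ _ => ranked_buy_mono hsel hv hv0

theorem Skimmed.next_deviateConsumer {i : Fin N} {θ : Assignment N} {h : History N}
    (hs : Skimmed {i} θ h) (d : History N → ℝ → Prop) (p : ℝ) :
    Skimmed {i} θ (Duropoly.next ((rankedProfile T sel v).deviateConsumer i d) θ h p) :=
  hs.next fun b hb c hc hle hbuy => by
    rw [deviateConsumer_buy_of_ne _ hb] at hbuy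
    rw [deviateConsumer_buy_of_ne _ hc]
    exact ranked_buy_mono hsel hv hv0 hle hbuy

theorem skimmed_play {θ : Assignment N} (n : ℕ) :
    Skimmed ∅ θ (play (rankedProfile T sel v) θ n []) := by
  induction n with
  | zero => trivial
  | succ n ih =>
    rw [play_succ]
    exact ih.next_ranked hsel hv hv0 _

theorem play_incomplete {θ : Assignment N} (n : ℕ) {h : History N} (hs : Skimmed ∅ θ h) :
    play (incompleteProfile T sel v) θ n h = play (rankedProfile T sel v) θ n h :=
  play_congr (fun _ hh => agreeAt_incomplete fun _ hc => hh.believedRank_eq_of_empty hc)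
    (fun _ p hh => hh.next_ranked hsel hv hv0 p) n hs

theorem play_complete {θ : Assignment N} (n : ℕ) {h : History N} (hs : Skimmed ∅ θ h) :
    play (completeProfile T sel v) θ n h = play (rankedProfile T sel v) θ n h :=
  play_congr (fun _ hh => agreeAt_complete hh) (fun _ p hh => hh.next_ranked hsel hv hv0 p) n hs

/-! ### Revenue -/

theorem revenue_step_le {θ : Assignment N} {h : History N} {r : ℕ} (hr : h.length + (r + 1) = T)
    (hs : Skimmed ∅ θ h) (p : ℝ) :
    p * ((buyers (rankedProfile T sel v) θ h p).card : ℝ)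
        + tailProfit sel (List.ofFn v) r
          (N - (remaining h).card + (buyers (rankedProfile T sel v) θ h p).card)
      ≤ tailProfit sel (List.ofFn v) (r + 1) (N - (remaining h).card) := by
  have hw := antitone_headD_drop_ofFn hv hv0
  set B := buyers (rankedProfile T sel v) θ h p with hB
  have hsub : B ⊆ remaining h := buyers_subset _ _ _ _
  rcases B.eq_empty_or_nonempty with h0 | hne
  · rw [h0, Finset.card_empty, Nat.cast_zero, mul_zero, zero_add]
    exact tailProfit_succ_le hsel hw _ _
  · obtain ⟨b, hb, hle⟩ := exists_mem_le_standing (θ := θ) hsub hne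
    have hbuy := (mem_buyers.1 (hB ▸ hb)).2
    rw [ranked_buy_of_skimmed hs (hsub hb), hs.eq_standing (hsub hb),
      show T - (h.length + 1) = r by omega] at hbuy
    have hp := hbuy.trans (threat_antitone hsel hw r hle)
    have hpos := hne.card_pos
    have hcard := Finset.card_le_card hsub
    have hN := card_remaining_le h
    have key := le_tailProfit_succ (w := List.ofFn v) hsel r
      (Nat.le_add_right (N - (remaining h).card) (B.card - 1)) (by rw [List.length_ofFn]; omega)
    rw [show N - (remaining h).card + (B.card - 1) + 1 = N - (remaining h).card + B.card by
      omega] at key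
    refine le_trans (add_le_add_left ?_ _) key
    rw [mul_comm]
    push_cast [Nat.cast_sub (show 1 ≤ B.card from hpos)]
    have : (0 : ℝ) ≤ B.card := Nat.cast_nonneg _
    nlinarith

theorem revenue_step_eq {θ : Assignment N} {h : History N} {r : ℕ} (hr : h.length + (r + 1) = T)
    (hs : Skimmed ∅ θ h) {p : ℝ} (hp : p = (rankedProfile T sel v).price θ h) :
    p * ((buyers (rankedProfile T sel v) θ h p).card : ℝ)
        + tailProfit sel (List.ofFn v) r
          (N - (remaining h).card + (buyers (rankedProfile T sel v) θ h p).card)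
      = tailProfit sel (List.ofFn v) (r + 1) (N - (remaining h).card) := by
  have hw := antitone_headD_drop_ofFn hv hv0
  refine le_antisymm (revenue_step_le hsel hv hv0 hr hs p) ?_
  rw [ranked_price, show T - h.length = r + 1 by omega] at hp
  set B := buyers (rankedProfile T sel v) θ h p with hB
  have hsub : B ⊆ remaining h := buyers_subset _ _ _ _
  have hcard := Finset.card_le_card hsub
  have hN := card_remaining_le h
  rcases Nat.eq_zero_or_pos (remaining h).card with h0 | hpos
  · rw [show B.card = 0 by omega, h0, tailProfit_of_length_le (by simp),
      tailProfit_of_length_le (by simp)]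
    simp
  obtain ⟨j, haj, hj, hpj, hprofit⟩ := exists_lastBuyer (w := List.ofFn v) hsel r
    (a := N - (remaining h).card) (by rw [List.length_ofFn]; omega)
  rw [← hp] at hpj
  rw [List.length_ofFn] at hj
  -- Otherwise the highest non-buyer stands at `j` or above, and her threat price would make her
  -- accept.
  have hjB : j + 1 ≤ N - (remaining h).card + B.card := by
    by_contra! hlt
    obtain ⟨i, hi, hiB⟩ := Finset.exists_mem_notMem_of_card_lt_card
      (show B.card < (remaining h).card by omega)
    obtain ⟨c, hc, hcB, hle⟩ := exists_notMem_standing_le (θ := θ) hi hiB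
    refine hcB (hB ▸ mem_buyers.2 ⟨hc, ?_⟩)
    rw [ranked_buy_of_skimmed hs hc, hs.eq_standing hc, show T - (h.length + 1) = r by omega, hpj]
    exact threat_antitone hsel hw r (by omega)
  -- Ties in threat prices may bring in buyers beyond `j`; selling to them now loses nothing.
  have h1 := tailProfit_le_add hsel hw r hjB (by rw [List.length_ofFn]; omega)
  have h2 := threat_antitone hsel hw r (Nat.le_succ j)
  rw [← hpj] at h2
  have h3 : ((j + 1 : ℕ) : ℝ) ≤ ((N - (remaining h).card + B.card : ℕ) : ℝ) := by
    exact_mod_cast hjB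
  have h4 := mul_le_mul_of_nonneg_left h2 (sub_nonneg.2 h3)
  rw [hprofit, ← hpj]
  push_cast at h1 h3 h4 ⊢
  linarith

theorem revenue_play_deviateSeller_le {θ : Assignment N} (d : History N → ℝ) (r : ℕ)
    {h : History N} (hr : h.length + r = T) (hs : Skimmed ∅ θ h) :
    revenue (play ((rankedProfile T sel v).deviateSeller d) θ r h)
      ≤ revenue h + tailProfit sel (List.ofFn v) r (N - (remaining h).card) := by
  induction r generalizing h with
  | zero => exact (add_zero (revenue h)).ge
  | succ r ih =>
    have hn : next ((rankedProfile T sel v).deviateSeller d) θ h (d h)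
      = next (rankedProfile T sel v) θ h (d h) := rfl
    have h1 := ih (h := next (rankedProfile T sel v) θ h (d h))
      (by rw [next, List.length_cons]; omega) (hs.next_ranked hsel hv hv0 _)
    have h2 := revenue_step_le hsel hv hv0 hr hs (d h)
    rw [next, revenue_cons, sub_card_remaining_cons (buyers_subset _ _ _ _)] at h1
    refine h1.trans ?_
    dsimp only at h1 ⊢
    linarith

theorem revenue_play_ranked {θ : Assignment N} (r : ℕ) {h : History N} (hr : h.length + r = T)
    (hs : Skimmed ∅ θ h) :
    revenue (play (rankedProfile T sel v) θ r h)
      = revenue h + tailProfit sel (List.ofFn v) r (N - (remaining h).card) := by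
  induction r generalizing h with
  | zero => exact (add_zero (revenue h)).symm
  | succ r ih =>
    have h1 := ih (h := next (rankedProfile T sel v) θ h ((rankedProfile T sel v).price θ h))
      (by rw [next, List.length_cons]; omega) (hs.next_ranked hsel hv hv0 _)
    have h2 := revenue_step_eq hsel hv hv0 hr hs rfl
    rw [play, h1, next, revenue_cons, sub_card_remaining_cons (buyers_subset _ _ _ _)]
    dsimp only
    linarith

/-! ### Consumers -/

/-- If consumer `i` refuses the price, the next price is lower. -/
theorem price_lt_of_not_buy {θ : Assignment N} {h : History N} {r : ℕ}
    (hr : h.length + 1 + (r + 1) = T) {i : Fin N} (hi : i ∈ remaining h) {p : ℝ}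
    (hb : ¬ (rankedProfile T sel v).buy i θ h p) :
    (rankedProfile T sel v).price θ (next (rankedProfile T sel v) θ h p) < p := by
  have hw := antitone_headD_drop_ofFn hv hv0
  have hT : h.length + 1 ≠ T := by omega
  obtain ⟨c, hc, hcB, hle⟩ := exists_notMem_standing_le (θ := θ) hi
    (fun hm => hb (mem_buyers.1 hm).2)
  have hcb : ¬ (rankedProfile T sel v).buy c θ h p := fun hm => hcB (mem_buyers.2 ⟨hc, hm⟩)
  rw [ranked_buy hT, not_le] at hcb
  rw [ranked_price, next, sub_card_remaining_cons (buyers_subset _ _ _ _), List.length_cons]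
  exact (threat_antitone hsel hw _ hle).trans_lt hcb

theorem sub_price_le_utility {θ : Assignment N} (r : ℕ) {h : History N}
    (hr : h.length + (r + 1) = T) {i : Fin N} (hi : i ∈ remaining h) :
    v (θ i) - (rankedProfile T sel v).price θ h
      ≤ utility v θ i (play (rankedProfile T sel v) θ (r + 1) h) := by
  induction r generalizing h with
  | zero =>
    rw [play]
    by_cases hb : (rankedProfile T sel v).buy i θ h ((rankedProfile T sel v).price θ h)
    · rw [utility_play_next_of_buy v _ θ 0 hi hb]
    · have hm : i ∈ remaining (next (rankedProfile T sel v) θ h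
          ((rankedProfile T sel v).price θ h)) :=
        Finset.mem_sdiff.2 ⟨hi, fun hm => hb (mem_buyers.1 hm).2⟩
      rw [play, utility_of_mem_remaining v θ hm]
      rw [ranked_buy_last (by omega)] at hb
      linarith
  | succ r ih =>
    rw [play]
    by_cases hb : (rankedProfile T sel v).buy i θ h ((rankedProfile T sel v).price θ h)
    · rw [utility_play_next_of_buy v _ θ _ hi hb]
    · have hm : i ∈ remaining (next (rankedProfile T sel v) θ h
          ((rankedProfile T sel v).price θ h)) :=
        Finset.mem_sdiff.2 ⟨hi, fun hm => hb (mem_buyers.1 hm).2⟩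
      have h1 := ih (by rw [next, List.length_cons]; omega) hm
      have h2 := price_lt_of_not_buy hsel hv hv0 (r := r) (by omega) hi hb
      linarith

/-- A consumer who should accept `p` cannot gain by refusing once. -/
theorem utility_wait_le {θ : Assignment N} {h : History N} {r : ℕ}
    (hr : h.length + 1 + (r + 1) = T) {i : Fin N} (hi : i ∈ remaining h) {p : ℝ}
    (hb : (rankedProfile T sel v).buy i θ h p) :
    utility v θ i (play (rankedProfile T sel v) θ (r + 1)
        ((p, (buyers (rankedProfile T sel v) θ h p).erase i) :: h)) ≤ v (θ i) - p := by
  have hw := antitone_headD_drop_ofFn hv hv0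
  have hT : h.length + 1 ≠ T := by omega
  set B := buyers (rankedProfile T sel v) θ h p with hB
  set h' : History N := (p, B.erase i) :: h with hh'
  have hsub : B ⊆ remaining h := buyers_subset _ _ _ _
  have hiB : i ∈ B := mem_buyers.2 ⟨hi, hb⟩
  have hi' : i ∈ remaining h' := Finset.mem_sdiff.2 ⟨hi, Finset.notMem_erase i B⟩
  have hlen : h'.length = h.length + 1 := rfl
  have hstart : N - (remaining h').card = N - (remaining h).card + (B.card - 1) := by
    rw [hh', sub_card_remaining_cons ((B.erase_subset i).trans hsub),
      Finset.card_erase_of_mem hiB]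
  -- With `i` staying, the next tail starts one position earlier, at or above the standing of the
  -- last consumer who accepted `p`.
  have hle : p ≤ (rankedProfile T sel v).price θ h' := by
    obtain ⟨b, hbB, hbs⟩ := exists_mem_le_standing (θ := θ) hsub ⟨i, hiB⟩
    have hbb := (mem_buyers.1 (hB ▸ hbB)).2
    rw [ranked_buy hT] at hbb
    rw [ranked_price, hlen, hstart]
    exact hbb.trans (threat_antitone hsel hw _ hbs)
  -- Everyone above `i` accepts whatever `i` should accept, and is gone.
  have hrank : standing i θ h' = N - (remaining h').card := by
    have : actualRank i θ h' = 0 := by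
      rw [actualRank, Finset.card_eq_zero, Finset.filter_eq_empty_iff]
      intro c hc hlt
      obtain ⟨hc1, hc2⟩ := Finset.mem_sdiff.1 hc
      refine hc2 (Finset.mem_erase.2 ⟨fun he => (he ▸ hlt).false, ?_⟩)
      exact mem_buyers.2 ⟨hc1, ranked_buy_mono hsel hv hv0 hlt.le hb⟩
    rw [standing, this, add_zero]
  have hbuy : (rankedProfile T sel v).buy i θ h' ((rankedProfile T sel v).price θ h') := by
    have hle' := threat_succ_le hsel hw r (N - (remaining h').card)
    rw [ranked_price, show T - h'.length = r + 1 by omega]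
    rcases Nat.eq_zero_or_pos r with rfl | hpos
    · rw [ranked_buy_last (by omega), ← threat_zero_ofFn sel v]
      refine hle'.trans (threat_antitone hsel hw 0 ?_)
      rw [← hrank]
      exact le_standing θ h' i
    · rw [ranked_buy (by omega), hrank, show T - (h'.length + 1) = r by omega]
      exact hle'
  rw [play, utility_play_next_of_buy v _ θ _ hi' hbuy]
  linarith

theorem sub_le_utility_next {θ : Assignment N} {i : Fin N} (r : ℕ) {h : History N}
    (hr : h.length + 1 + r = T) (hi : i ∈ remaining h) (p : ℝ) :
    v (θ i) - p
      ≤ utility v θ i (play (rankedProfile T sel v) θ r (next (rankedProfile T sel v) θ h p)) := by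
  by_cases hb : (rankedProfile T sel v).buy i θ h p
  · rw [utility_play_next_of_buy v _ θ _ hi hb]
  · have hi' := mem_remaining_erase hi p (buyers (rankedProfile T sel v) θ h p)
    obtain _ | r := r
    · rw [play, next_of_not_buy hb, utility_of_mem_remaining v θ hi']
      rw [ranked_buy_last (by omega)] at hb
      linarith
    · have h1 := price_lt_of_not_buy hsel hv hv0 hr hi hb
      rw [next_of_not_buy hb] at h1 ⊢
      have h2 := sub_price_le_utility (T := T) (θ := θ) hsel hv hv0 r (by rw [List.length_cons]; omega) hi'
      linarith

/-- Buying now is dominated by `sub_le_utility_next`. After waiting, induction replaces the rest of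
the deviation by the prescribed play, which leaves a single refusal to compare. -/
theorem utility_deviateConsumer_le {θ : Assignment N} {i : Fin N} (d : History N → ℝ → Prop)
    (r : ℕ) {h : History N} (hr : h.length + 1 + r = T) (hi : i ∈ remaining h) (p : ℝ) :
    utility v θ i (play ((rankedProfile T sel v).deviateConsumer i d) θ r
        (next ((rankedProfile T sel v).deviateConsumer i d) θ h p))
      ≤ utility v θ i (play (rankedProfile T sel v) θ r (next (rankedProfile T sel v) θ h p)) := by
  induction r generalizing h p with
  | zero =>
    by_cases hd : d h p
    · rw [utility_play_next_of_buy v _ θ _ hi (by rwa [deviateConsumer_buy_self])]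
      exact sub_le_utility_next hsel hv hv0 0 hr hi p
    · have hi' := mem_remaining_erase hi p (buyers (rankedProfile T sel v) θ h p)
      rw [next_of_not_buy (by rwa [deviateConsumer_buy_self]), erase_buyers_deviateConsumer, play,
        utility_of_mem_remaining v θ hi']
      by_cases hb : (rankedProfile T sel v).buy i θ h p
      · rw [utility_play_next_of_buy v _ θ _ hi hb]
        rw [ranked_buy_last (by omega)] at hb
        linarith
      · rw [play, next_of_not_buy hb, utility_of_mem_remaining v θ hi']
  | succ r ih =>
    by_cases hd : d h p
    · rw [utility_play_next_of_buy v _ θ _ hi (by rwa [deviateConsumer_buy_self])]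
      exact sub_le_utility_next hsel hv hv0 (r + 1) hr hi p
    · have hi' := mem_remaining_erase hi p (buyers (rankedProfile T sel v) θ h p)
      rw [next_of_not_buy (by rwa [deviateConsumer_buy_self]), erase_buyers_deviateConsumer, play]
      refine (ih (by rw [List.length_cons]; omega) hi' _).trans ?_
      by_cases hb : (rankedProfile T sel v).buy i θ h p
      · rw [utility_play_next_of_buy v _ θ _ hi hb]
        exact utility_wait_le hsel hv hv0 hr hi hb
      · rw [next_of_not_buy hb]
        rfl

end Ranked

/-! ### Bayes consistency and equilibrium -/

section Equilibrium

variable {T : ℕ} {sel : ℕ → List ℝ → ℕ} {v : Fin N → ℝ}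

theorem card_buyers_of_skimmed {θ : Assignment N} {h : History N} (hs : Skimmed ∅ θ h) (p : ℝ) :
    (buyers (rankedProfile T sel v) θ h p).card
      = (Finset.univ.filter fun k : Fin N => N - (remaining h).card ≤ k ∧
          p ≤ threat sel (List.ofFn v) (T - (h.length + 1)) k).card := by
  rw [← Finset.card_map θ.toEmbedding]
  congr 1
  ext k
  rw [Finset.mem_map_equiv, mem_buyers, Finset.mem_filter]
  have h1 := hs.mem_remaining_iff (c := θ.symm k)
  rw [Equiv.apply_symm_apply] at h1
  constructor
  · rintro ⟨hc, hb⟩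
    rw [ranked_buy_of_skimmed hs hc, Equiv.apply_symm_apply] at hb
    exact ⟨Finset.mem_univ _, h1.1 hc, hb⟩
  · rintro ⟨-, hk, hp⟩
    refine ⟨h1.2 hk, ?_⟩
    rwa [ranked_buy_of_skimmed hs (h1.2 hk), Equiv.apply_symm_apply]

theorem staticProfit_eq (hsel : IsArgmaxRule sel) (v : Fin N → ℝ) :
    staticProfit v = profit sel 1 (List.ofFn v) := by
  change _ = tailProfit sel (List.ofFn v) 1 0
  rcases Nat.eq_zero_or_pos N with rfl | hN
  -- The real supremum over an empty type is 0, as the convention for `N = 0` demands.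
  · rw [staticProfit, Real.iSup_of_isEmpty, tailProfit_of_length_le (by simp)]
  have : Nonempty (Fin N) := ⟨⟨0, hN⟩⟩
  have hz (c : ℕ) : tailProfit sel (List.ofFn v) 0 c = 0 := rfl
  refine le_antisymm (ciSup_le fun k => ?_) ?_
  · have := le_tailProfit_succ (w := List.ofFn v) hsel 0 (Nat.zero_le k) (by simp)
    rw [threat_zero_ofFn, hz] at this
    simpa using this
  · obtain ⟨j, -, hj, -, hp⟩ := exists_lastBuyer (w := List.ofFn v) hsel 0
      (a := 0) (by simpa using hN)
    rw [List.length_ofFn] at hj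
    have hthr : threat sel (List.ofFn v) 0 j = v ⟨j, hj⟩ := threat_zero_ofFn sel v ⟨j, hj⟩
    rw [hp, hz, hthr]
    refine le_trans ?_ (le_ciSup (f := fun k : Fin N => ((k : ℕ) + 1 : ℝ) * v k)
      (Set.finite_range _).bddAbove ⟨j, hj⟩)
    simp

variable (hsel : IsArgmaxRule sel) (hv : Antitone v) (hv0 : ∀ k, 0 ≤ v k)
include hsel hv hv0

/-- Both assignments yield equally many buyers, so two different sets of buyers would each contain
someone missing from the other. The skimming order under `θ'` then makes the missing buyer accept as
well. -/
theorem play_eq_of_skimmed {X : Set (Fin N)} {θ θ' : Assignment N} (hX : ∀ x ∈ X, θ' x = θ x)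
    {n : ℕ} (hXr : ∀ x ∈ X, x ∈ remaining (play (rankedProfile T sel v) θ n []))
    (hs : Skimmed X θ' (play (rankedProfile T sel v) θ n [])) :
    play (rankedProfile T sel v) θ' n [] = play (rankedProfile T sel v) θ n [] := by
  induction n with
  | zero => rfl
  | succ n ih =>
    rw [play_succ] at hXr hs ⊢
    rw [play_succ _ θ, ih (fun x hx => remaining_cons_subset _ _ (hXr x hx)) hs.1]
    have hθ := skimmed_play (T := T) hsel hv hv0 (θ := θ) n
    have hθ' := skimmed_play (T := T) hsel hv hv0 (θ := θ') n
    rw [ih (fun x hx => remaining_cons_subset _ _ (hXr x hx)) hs.1] at hθ'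
    set h := play (rankedProfile T sel v) θ n []
    set p := (rankedProfile T sel v).price θ h
    change (p, buyers _ θ' h p) :: h = (p, buyers _ θ h p) :: h
    congr 2
    refine Finset.eq_of_subset_of_card_le (fun c hc => ?_) ?_
    · by_contra hcB
      have hcard : (buyers (rankedProfile T sel v) θ' h p).card
          = (buyers (rankedProfile T sel v) θ h p).card := by
        rw [card_buyers_of_skimmed hθ, card_buyers_of_skimmed hθ']
      obtain ⟨b, hb, hbB⟩ : ∃ b ∈ buyers (rankedProfile T sel v) θ h p,
          b ∉ buyers (rankedProfile T sel v) θ' h p := by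
        by_contra! hsub
        exact hcB ((Finset.eq_of_subset_of_card_le hsub hcard.le).symm ▸ hc)
      obtain ⟨hcr, hcb⟩ := mem_buyers.1 hc
      have hbX : b ∉ X := fun hx => notMem_remaining_cons hb (hXr b hx)
      -- Members of `X` have the same position in both assignments and so decide alike.
      have hcX : c ∉ X := fun hx => by
        refine hcB (mem_buyers.2 ⟨hcr, ?_⟩)
        rw [ranked_buy_of_skimmed hθ' hcr, hX c hx] at hcb
        rwa [ranked_buy_of_skimmed hθ hcr]
      have hlt := hs.2 b hb c (Finset.mem_sdiff.2 ⟨hcr, hcB⟩) hbX hcX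
      exact hbB (mem_buyers.2
        ⟨(mem_buyers.1 hb).1, ranked_buy_mono hsel hv hv0 hlt.le hcb⟩)
    · rw [card_buyers_of_skimmed hθ, card_buyers_of_skimmed hθ']

theorem skimmed_iff_play_eq {X : Set (Fin N)} {θ θ' : Assignment N} (hX : ∀ x ∈ X, θ' x = θ x)
    {n : ℕ} (hXr : ∀ x ∈ X, x ∈ remaining (play (rankedProfile T sel v) θ n [])) :
    Skimmed X θ' (play (rankedProfile T sel v) θ n [])
      ↔ play (rankedProfile T sel v) θ' n [] = play (rankedProfile T sel v) θ n [] := by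
  refine ⟨play_eq_of_skimmed hsel hv hv0 hX hXr, fun he => ?_⟩
  rw [← he]
  exact (skimmed_play hsel hv hv0 n).mono (Set.empty_subset X)

theorem seller_rational_ranked {θ : Assignment N} {h : History N} (hT : h.length < T)
    (hs : Skimmed ∅ θ h) (d : History N → ℝ) :
    revenue (play ((rankedProfile T sel v).deviateSeller d) θ (T - h.length) h)
      ≤ revenue (play (rankedProfile T sel v) θ (T - h.length) h) := by
  have hr : h.length + (T - h.length) = T := by omega
  rw [revenue_play_ranked hsel hv hv0 _ hr hs]
  exact revenue_play_deviateSeller_le hsel hv hv0 d _ hr hs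

theorem isPerfectEquilibrium_incomplete :
    IsPerfectEquilibrium T v (ownValue N) (incompleteProfile T sel v) (skimmingBeliefs N) where
  price_informed _ _ _ _ := rfl
  buy_informed i θ θ' h p (hθ : θ i = θ' i) := by
    simp only [incompleteProfile, threatProfile, believedRank, hθ]
  seller_belief_informed _ _ _ _ := rfl
  consumer_belief_informed i θ θ' h (hθ : θ i = θ' i) := by
    simp only [skimmingBeliefs, hθ]
  seller_belief_subset _ _ _ _ := trivial
  consumer_belief_subset _ _ _ _ hθ' := hθ'.1.symm
  seller_belief_nonempty _ h _ := by
    obtain ⟨θ, hθ⟩ := exists_skimmed h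
    exact ⟨θ, skimmed_of_waiting fun b _ c _ => hθ b c⟩
  consumer_belief_nonempty θ h _ i _ := exists_skimmed_apply_eq h i (θ i)
  seller_bayes θ θ' n _ := by
    rw [play_incomplete hsel hv hv0 n (skimmed_nil _ _), play_incomplete hsel hv hv0 n (skimmed_nil _ _)]
    exact (skimmed_iff_play_eq hsel hv hv0 (by simp) (by simp)).trans
      ⟨fun hp => ⟨trivial, hp⟩, fun hp => hp.2⟩
  consumer_bayes θ θ' n _ i hi := by
    rw [play_incomplete hsel hv hv0 n (skimmed_nil _ _)] at hi
    rw [play_incomplete hsel hv hv0 n (skimmed_nil _ _), play_incomplete hsel hv hv0 n (skimmed_nil _ _)]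
    constructor
    · rintro ⟨h1, h2⟩
      exact ⟨h1.symm, (skimmed_iff_play_eq hsel hv hv0
        (by simpa using h1) (by simpa using hi)).1 h2⟩
    · rintro ⟨h1, h2⟩
      exact ⟨Eq.symm h1, (skimmed_iff_play_eq hsel hv hv0
        (by simpa using Eq.symm h1) (by simpa using hi)).2 h2⟩
  seller_rational h _ hT _ θ hs d := by
    have hs : Skimmed ∅ θ h := hs
    have hdev : play ((incompleteProfile T sel v).deviateSeller d) θ (T - h.length) h
        = play ((rankedProfile T sel v).deviateSeller d) θ (T - h.length) h :=
      play_congr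
        (fun _ hh => (agreeAt_incomplete fun _ hc => hh.believedRank_eq_of_empty hc).deviateSeller d)
        (fun _ p hh => hh.next_ranked hsel hv hv0 p) _ hs
    rw [hdev, play_incomplete hsel hv hv0 _ hs]
    exact seller_rational_ranked hsel hv hv0 hT hs d
  consumer_rational h _ hT p i hi _ θ hs d := by
    have hs : Skimmed {i} θ h := hs.2
    have agree (g : History N) (hg : Skimmed {i} θ g) (hig : i ∈ remaining g) :
        AgreeAt (incompleteProfile T sel v) (rankedProfile T sel v) θ g :=
      agreeAt_incomplete fun _ hc => hg.believedRank_eq hig hc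
    rw [(agree h hs hi).next_eq, ((agree h hs hi).deviateConsumer i d).next_eq,
      utility_play_congr agree (fun _ p hh => hh.next_ranked hsel hv hv0 p) v _
        (hs.next_ranked hsel hv hv0 p),
      utility_play_congr (fun g hg hig => (agree g hg hig).deviateConsumer i d)
        (fun _ p hh => hh.next_deviateConsumer hsel hv hv0 d p) v _
        (hs.next_deviateConsumer hsel hv hv0 d p)]
    exact utility_deviateConsumer_le hsel hv hv0 d _ (by omega) hi p

theorem isPerfectEquilibrium_ranked :
    IsPerfectEquilibrium T v (informedConsumers N) (rankedProfile T sel v)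
      (skimmingSellerBeliefs N) where
  price_informed _ _ _ _ := rfl
  buy_informed i θ θ' h p (hθ : θ = θ') := by rw [hθ]
  seller_belief_informed _ _ _ _ := rfl
  consumer_belief_informed i θ θ' h (hθ : θ = θ') := by rw [hθ]
  seller_belief_subset _ _ _ _ := trivial
  consumer_belief_subset _ _ _ _ hθ' := Eq.symm hθ'
  seller_belief_nonempty _ h _ := by
    obtain ⟨θ, hθ⟩ := exists_skimmed h
    exact ⟨θ, skimmed_of_waiting fun b _ c _ => hθ b c⟩
  consumer_belief_nonempty θ _ _ _ _ := ⟨θ, rfl⟩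
  seller_bayes θ θ' n _ :=
    (skimmed_iff_play_eq hsel hv hv0 (by simp) (by simp)).trans
      ⟨fun hp => ⟨trivial, hp⟩, fun hp => hp.2⟩
  consumer_bayes θ θ' n _ i _ := by
    constructor
    · intro he
      have he : θ' = θ := he
      exact ⟨he.symm, by rw [he]⟩
    · exact fun hp => Eq.symm hp.1
  seller_rational _ _ hT _ _ hs d := seller_rational_ranked hsel hv hv0 hT hs d
  consumer_rational _ _ _ p _ hi _ _ _ d :=
    utility_deviateConsumer_le hsel hv hv0 d _ (by omega) hi p

/-! ### Profit bounds -/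

theorem offer_one_le_profit_one : offer sel 1 (List.ofFn v) ≤ profit sel 1 (List.ofFn v) := by
  have hw := antitone_headD_drop_ofFn hv hv0
  change threat sel (List.ofFn v) 1 0 ≤ tailProfit sel (List.ofFn v) 1 0
  rcases Nat.eq_zero_or_pos N with rfl | hN
  · rw [tailProfit_of_length_le (by simp), threat_of_length_le (by simp)]
  · obtain ⟨j, -, -, hthr, hp⟩ := exists_lastBuyer (w := List.ofFn v) hsel 0
      (a := 0) (by simpa using hN)
    have h0 := threat_nonneg hsel hw 0 j
    have hz : tailProfit sel (List.ofFn v) 0 (j + 1) = 0 := rfl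
    have hj : (0 : ℝ) ≤ j := Nat.cast_nonneg j
    rw [hthr, hp, hz]
    push_cast
    nlinarith

end Equilibrium

end Duropoly

end

theorem mainTheorem7 (N T : ℕ) (hT : 1 ≤ T) (v : Fin N → ℝ) (hv : Antitone v)
    (hv0 : ∀ k, 0 ≤ v k) (sel : ℕ → List ℝ → ℕ) (hsel : Duropoly.IsArgmaxRule sel) :
    Duropoly.IsPerfectEquilibrium T v (Duropoly.ownValue N)
        (Duropoly.incompleteProfile T sel v) (Duropoly.skimmingBeliefs N) ∧
    Duropoly.IsPerfectEquilibrium T v (Duropoly.informedConsumers N)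
        (Duropoly.rankedProfile T sel v) (Duropoly.skimmingSellerBeliefs N) ∧
    ∀ θ : Duropoly.Assignment N,
      Duropoly.play (Duropoly.incompleteProfile T sel v) θ T []
          = Duropoly.play (Duropoly.completeProfile T sel v) θ T [] ∧
      Duropoly.play (Duropoly.rankedProfile T sel v) θ T []
          = Duropoly.play (Duropoly.completeProfile T sel v) θ T [] ∧
      Duropoly.revenue (Duropoly.play (Duropoly.incompleteProfile T sel v) θ T [])
          = Duropoly.profit sel T (List.ofFn v) ∧
      Duropoly.staticProfit v ≤ Duropoly.profit sel T (List.ofFn v) ∧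
      Duropoly.profit sel T (List.ofFn v)
          ≤ Duropoly.staticProfit v + Duropoly.offer sel 1 (List.ofFn v) ∧
      Duropoly.staticProfit v + Duropoly.offer sel 1 (List.ofFn v)
          ≤ 2 * Duropoly.staticProfit v := by
  have hw := Duropoly.antitone_headD_drop_ofFn hv hv0
  refine ⟨Duropoly.isPerfectEquilibrium_incomplete hsel hv hv0,
    Duropoly.isPerfectEquilibrium_ranked hsel hv hv0, fun θ => ?_⟩
  rw [Duropoly.play_incomplete hsel hv hv0 T (Duropoly.skimmed_nil _ _), Duropoly.play_complete hsel hv hv0 T (Duropoly.skimmed_nil _ _),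
    Duropoly.staticProfit_eq hsel v]
  refine ⟨rfl, rfl, ?_, Duropoly.tailProfit_mono_left hsel hw 0 hT,
    Duropoly.tailProfit_le_static_add hsel hw hT 0, ?_⟩
  · rw [Duropoly.revenue_play_ranked hsel hv hv0 T (by simp) (Duropoly.skimmed_nil _ _)]
    simp [Duropoly.revenue, Duropoly.remaining, Duropoly.tailProfit]
  · have := Duropoly.offer_one_le_profit_one hsel hv hv0
    linarith
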